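/- Let $S$ be a finite set and let $\langle S\mid R\rangle^+$ be a right-complemented presentation of a monoid $M$: $R$ contains no relation $w=\varepsilon$ with $w$ nonempty, no relation $s\cdots=s\cdots$ with $s\in S$, and at most one relation $s\cdots=t\cdots$ for all $s\neq t$ in $S$. If there is such a relation for $s\ne t$, write it $s\,\theta(s,t)=t\,\theta(t,s)$; put $\theta(s,s)=\varepsilon$. For words $u,v,u',v'\in S^*$, write $\overline u v\curvearrowright^* v'\overline{u'}$ if the signed word $v'\overline{u'}$ is obtained from $\overline u v$ by finitely many right-reversing steps, each replacing a subword $\overline s t$ ($s,t\in S$, $\theta(s,t)$ defined) by $\theta(s,t)\overline{\theta(t,s)}$. Assume that right-reversing is complete (whenever $u\hat v=v\hat u$ in $M$ for words $u,v,\hat u,\hat v$, there are words $u',v',w'$ with $\overline uv\curvearrowright^* v'\overline{u'}$ and $\hat u=u'w'$, $\hat v=v'w'$ in $M$) and that $M$ is noetherian (the relation "$b=cad$ with $c$ or $d$ non-invertible" between $a$ and $b$ is well-founded). An element $m$ is a right-lcm of $g,h\in M$ if it is a common right-multiple of $g$ and $h$ that left-divides every common right-multiple of $g$ and $h$. Under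 the above assumptions it is unique when it exists; it is then denoted by $\operatorname{lcm}(g,h)$, and the right-complement $g\backslash h$ is the element with $\operatorname{lcm}(g,h)=g\,(g\backslash h)$. A Garside family of $M$ is a subset of $M$ that generates $M$ and is closed under right-lcm and right-complement (whenever these exist). Starting with $G_0=S$ (its image in $M$), put $$G_{n+1}=G_n\cup\{\operatorname{lcm}(g,h),\; g\backslash h \;:\; g,h\in G_n \text{ having a right-lcm}\}.$$ 1. The right-lcms and right-complements in this process are computed by right-reversing: for all $u,v\in S^*$, the elements represented by $u,v$ have a right-lcm if and only if there are $u',v'\in S^*$ with $\overline uv\curvearrowright^* v'\overline{u'}$, and then $uv'$ represents the right-lcm and $v'$ represents $u\backslash v$. 2. The process stabilises (that is, $G_{n+1}=G_n$ for some $n$) if and only if $M$ has a finite Garside family. 3. If $G_{n+1}=G_n$, then $G_n$ is finite and is the smallest Garside family of $M$ among those that contain $S$. If moreover $S$ consists of atoms of $M$, then $G_n$ is the smallest Garside family of $M$; in particular it is a minimal Garside family. -/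

import Mathlib

namespace RightReversing

section Arithmetic

variable {M : Type*} [Monoid M]

/-- `m` is a right-lcm of `a` and `b`. In a monoid, `a ∣ m` means that `m = a * c` for some `c`,
that is, that `a` is a left-divisor of `m`. -/
def IsRightLcm (a b m : M) : Prop :=
  a ∣ m ∧ b ∣ m ∧ ∀ d : M, a ∣ d → b ∣ d → m ∣ d

/-- `c` is a right-complement `a \ b`: the product `a * c` is a right-lcm of `a` and `b`. -/
def IsRightComplement (a b c : M) : Prop :=
  IsRightLcm a b (a * c)

/-- `a` is a proper factor of `b`: `b = c * a * d` with at least one of `c`, `d` non-invertible. -/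
def IsProperFactor (a b : M) : Prop :=
  ∃ c d : M, c * a * d = b ∧ (¬ IsUnit c ∨ ¬ IsUnit d)

variable (M) in
/-- A monoid is noetherian if proper factoring is well-founded. -/
def IsNoetherianMonoid : Prop :=
  WellFounded (IsProperFactor : M → M → Prop)

/-- A Garside family: a generating family closed under right-lcm and right-complement. -/
structure IsGarsideFamily (G : Set M) : Prop where
  generates : Submonoid.closure G = ⊤
  lcm_mem : ∀ g ∈ G, ∀ h ∈ G, ∀ m : M, IsRightLcm g h m → m ∈ G
  complement_mem : ∀ g ∈ G, ∀ h ∈ G, ∀ c : M, IsRightComplement g h c → c ∈ G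

/-- One step of the closure process: add the right-lcms and the right-complements (when they
exist) of all pairs of elements of `G`. -/
def closureStep (G : Set M) : Set M :=
  G ∪ {m | ∃ g ∈ G, ∃ h ∈ G, IsRightLcm g h m} ∪ {c | ∃ g ∈ G, ∃ h ∈ G, IsRightComplement g h c}

/-- The sequence `G₀ = S`, `Gₙ₊₁ = closureStep Gₙ`. -/
def closureSeq (S : Set M) : ℕ → Set M
  | 0 => S
  | n + 1 => closureStep (closureSeq S n)

end Arithmetic

section Presentation

variable {α : Type*}

/-- `u = v` or `v = u` is one of the relations. -/
def SymmRel (rels : FreeMonoid α → FreeMonoid α → Prop) (u v : FreeMonoid α) : Prop :=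
  rels u v ∨ rels v u

/-- Right-complemented presentations: no relation `w = ε` with `w` nonempty, no relation
`s… = s…`, and at most one relation `s… = t…` for each pair of distinct letters. -/
structure IsRightComplemented (rels : FreeMonoid α → FreeMonoid α → Prop) : Prop where
  no_eps : ∀ w : FreeMonoid α, SymmRel rels w 1 → w = 1
  no_same : ∀ (s : α) (x y : FreeMonoid α),
    ¬ rels (FreeMonoid.of s * x) (FreeMonoid.of s * y)
  unique : ∀ (s t : α), s ≠ t → ∀ x y x' y' : FreeMonoid α,
    SymmRel rels (FreeMonoid.of s * x) (FreeMonoid.of t * y) →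
    SymmRel rels (FreeMonoid.of s * x') (FreeMonoid.of t * y') → x = x' ∧ y = y'

/-- The graph of the syntactic right-complement `θ`: `θ(s,t)` and `θ(t,s)` are defined and equal to
`x` and `y`. -/
def SyntacticComplement (rels : FreeMonoid α → FreeMonoid α → Prop) (s t : α)
    (x y : FreeMonoid α) : Prop :=
  (s = t ∧ x = 1 ∧ y = 1) ∨
    (s ≠ t ∧ SymmRel rels (FreeMonoid.of s * x) (FreeMonoid.of t * y))

/-- Signed words: `(s, true)` is the letter `s`, `(s, false)` is its formal inverse. -/
abbrev SignedWord (α : Type*) := List (α × Bool)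

/-- A word, seen as a signed word. -/
def posWord (u : FreeMonoid α) : SignedWord α :=
  u.toList.map fun s => (s, true)

/-- The formal inverse of a word: the letters are reversed in order and inverted. -/
def negWord (u : FreeMonoid α) : SignedWord α :=
  u.toList.reverse.map fun s => (s, false)

/-- One step of right-reversing: replace a subword `s⁻¹ t` by `θ(s,t) θ(t,s)⁻¹`. -/
inductive ReversingStep (rels : FreeMonoid α → FreeMonoid α → Prop) :
    SignedWord α → SignedWord α → Prop
  | step (w₁ w₂ : SignedWord α) (s t : α) (x y : FreeMonoid α)
      (h : SyntacticComplement rels s t x y) :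
      ReversingStep rels (w₁ ++ [(s, false), (t, true)] ++ w₂)
        (w₁ ++ (posWord x ++ negWord y) ++ w₂)

/-- Right-reversing of `u⁻¹ v` leads, in finitely many steps, to `v' u'⁻¹`. -/
def ReversesTo (rels : FreeMonoid α → FreeMonoid α → Prop) (u v u' v' : FreeMonoid α) : Prop :=
  Relation.ReflTransGen (ReversingStep rels) (negWord u ++ posWord v) (posWord v' ++ negWord u')

/-- Right-reversing is complete: every equality `u v₁ = v u₁` in the presented monoid factors
through right-reversing. -/
def ReversingComplete (rels : FreeMonoid α → FreeMonoid α → Prop) : Prop :=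
  ∀ u v u₁ v₁ : FreeMonoid α,
    PresentedMonoid.mk rels (u * v₁) = PresentedMonoid.mk rels (v * u₁) →
    ∃ u' v' w' : FreeMonoid α, ReversesTo rels u v u' v' ∧
      PresentedMonoid.mk rels (u' * w') = PresentedMonoid.mk rels u₁ ∧
      PresentedMonoid.mk rels (v' * w') = PresentedMonoid.mk rels v₁

/-- The sequence `Gₙ` in the presented monoid, starting with the set of generators. -/
def garsideSeq (rels : FreeMonoid α → FreeMonoid α → Prop) : ℕ → Set (PresentedMonoid rels) :=
  closureSeq (Set.range (PresentedMonoid.of rels))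

end Presentation

end RightReversing

open scoped Pointwise

namespace RightReversing

/-! ### Right-lcms, right-complements and powers of a Garside family -/

section Divisibility

variable {M : Type*} [Monoid M]

/-! Right-reversing is confluent: two redexes cannot overlap, and each has one possible result. So
`u⁻¹ v` has at most one normal form `v' u'⁻¹`. Reversing is also sound, giving `u v' = v u'`.
Completeness makes every common right-multiple factor through this single normal form, which is
therefore the right-lcm. The same uniqueness, applied to `s⁻¹ s`, gives left-cancellation; the
absence of relations `w = ε` excludes nontrivial invertible elements. So `M` satisfies
`IsConditionalLcmMonoid`, and the rest is divisibility theory.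

A stable `Gₙ` is finite, since each step adds at most one lcm and one complement per pair, and it is
a Garside family by construction. By induction it lies in every Garside family containing `S`; atoms
lie in every generating set, so for atoms this last condition is automatic.

Conversely, a finite Garside family `G` need not contain `S`, but some power `G ^ k` does. Stacking
lcm squares into grids shows that `G ^ k` is again closed under right-lcm and right-complement
(`lcm_mem_pow`, `complement_mem_pow`). All `Gₙ` then lie in the finite set `G ^ k`, so the
increasing sequence stabilises. -/

theorem IsRightLcm.symm {a b m : M} (h : IsRightLcm a b m) : IsRightLcm b a m :=
  ⟨h.2.1, h.1, fun d hb ha => h.2.2 d ha hb⟩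

theorem IsRightLcm.self (a : M) : IsRightLcm a a a :=
  ⟨dvd_rfl, dvd_rfl, fun _ h _ => h⟩

theorem isRightLcm_one_right (a : M) : IsRightLcm a 1 a :=
  ⟨dvd_rfl, one_dvd a, fun _ h _ => h⟩

/-- A left-cancellative monoid without nontrivial invertible elements in which any two elements
with a common right-multiple have a right-lcm. -/
structure IsConditionalLcmMonoid (M : Type*) [Monoid M] : Prop where
  cancel : ∀ a b c : M, a * b = a * c → b = c
  eq_one_of_mul : ∀ a b : M, a * b = 1 → a = 1
  exists_lcm : ∀ a b d : M, a ∣ d → b ∣ d → ∃ m, IsRightLcm a b m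

namespace IsConditionalLcmMonoid


theorem dvd_of_mul_dvd_mul (hM : IsConditionalLcmMonoid M) {a b c : M} (h : a * b ∣ a * c) : b ∣ c := by
  obtain ⟨d, hd⟩ := h
  exact ⟨d, hM.cancel a _ _ (by rw [hd, mul_assoc])⟩

theorem dvd_antisymm (hM : IsConditionalLcmMonoid M) {a b : M} (h₁ : a ∣ b) (h₂ : b ∣ a) : a = b := by
  obtain ⟨c, rfl⟩ := h₁
  obtain ⟨d, hd⟩ := h₂
  have h : c * d = 1 := hM.cancel a _ _ (by rw [mul_one, ← mul_assoc, ← hd])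
  rw [hM.eq_one_of_mul c d h, mul_one]

theorem lcm_unique (hM : IsConditionalLcmMonoid M) {a b m m' : M} (h : IsRightLcm a b m) (h' : IsRightLcm a b m') : m = m' :=
  hM.dvd_antisymm (h.2.2 _ h'.1 h'.2.1) (h'.2.2 _ h.1 h.2.1)

theorem complement_unique (hM : IsConditionalLcmMonoid M) {a b c c' : M} (h : IsRightComplement a b c)
    (h' : IsRightComplement a b c') : c = c' :=
  hM.cancel a _ _ (hM.lcm_unique h h')

/-- Right-lcm squares can be stacked. -/
theorem isRightLcm_mul (hM : IsConditionalLcmMonoid M) {a₁ a₂ b b₁ a₁' b₂ : M} (h₁ : IsRightLcm a₁ b (a₁ * b₁))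
    (e₁ : a₁ * b₁ = b * a₁') (h₂ : IsRightLcm a₂ b₁ (a₂ * b₂)) :
    IsRightLcm (a₁ * a₂) b (a₁ * a₂ * b₂) := by
  refine ⟨dvd_mul_right _ _, ?_, fun d hd hb => ?_⟩
  · obtain ⟨x, hx⟩ := h₂.2.1
    rw [mul_assoc, hx, ← mul_assoc, e₁, mul_assoc]
    exact dvd_mul_right _ _
  · obtain ⟨e, rfl⟩ := hd
    have hb₁ : b₁ ∣ a₂ * e := by
      apply hM.dvd_of_mul_dvd_mul (a := a₁)
      rw [← mul_assoc]
      exact h₁.2.2 _ (by rw [mul_assoc]; exact dvd_mul_right _ _) hb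
    have := mul_dvd_mul_left a₁ (h₂.2.2 _ (dvd_mul_right _ _) hb₁)
    simpa only [mul_assoc] using this

/-- The right-lcm of two products is the product of the diagonals of a `2 × 2` grid. -/
theorem isRightLcm_mul_mul (hM : IsConditionalLcmMonoid M) {a₁ a₂ b₁ b₂ a₁' b₁' a₂' b₂' x y m : M}
    (h₁ : IsRightLcm a₁ b₁ (a₁ * b₁')) (e₁ : a₁ * b₁' = b₁ * a₁')
    (h₂ : IsRightLcm a₂ b₁' (a₂ * x)) (e₂ : a₂ * x = b₁' * a₂')
    (h₃ : IsRightLcm b₂ a₁' (b₂ * y)) (e₃ : b₂ * y = a₁' * b₂')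
    (h₄ : IsRightLcm a₂' b₂' m) :
    IsRightLcm (a₁ * a₂) (b₁ * b₂) (a₁ * b₁' * m) := by
  refine ⟨?_, ?_, fun d ha hb => ?_⟩
  · obtain ⟨z, rfl⟩ := h₄.1
    refine ⟨x * z, ?_⟩
    rw [← mul_assoc, mul_assoc a₁, ← e₂]
    simp only [mul_assoc]
  · obtain ⟨z, rfl⟩ := h₄.2.1
    refine ⟨y * z, ?_⟩
    rw [e₁, ← mul_assoc, mul_assoc b₁, ← e₃]
    simp only [mul_assoc]
  -- A common multiple is `lcm(a₁, b₁) * e`; cancelling along the two outer squares shows that `a₂'`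
  -- and `b₂'` both divide `e`.
  · obtain ⟨e, rfl⟩ := h₁.2.2 d ((dvd_mul_right _ _).trans ha) ((dvd_mul_right _ _).trans hb)
    apply mul_dvd_mul_left
    apply h₄.2.2
    · apply hM.dvd_of_mul_dvd_mul (a := b₁')
      rw [← e₂]
      refine h₂.2.2 _ (hM.dvd_of_mul_dvd_mul (a := a₁) ?_) (dvd_mul_right _ _)
      rwa [← mul_assoc]
    · apply hM.dvd_of_mul_dvd_mul (a := a₁')
      rw [← e₃]
      refine h₃.2.2 _ (hM.dvd_of_mul_dvd_mul (a := b₁) ?_) (dvd_mul_right _ _)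
      rwa [← mul_assoc, ← e₁]

/-- If any two elements of `A` and `B` with a common right-multiple have complements in `A` and
`B`, the same holds for `A` and the powers of `B`. -/
theorem exists_square_pow_right (hM : IsConditionalLcmMonoid M) {A B : Set M}
    (hAB : ∀ a ∈ A, ∀ b ∈ B, ∀ d, a ∣ d → b ∣ d →
      ∃ a' ∈ A, ∃ b' ∈ B, a * b' = b * a' ∧ IsRightLcm a b (a * b')) (k : ℕ) :
    ∀ a ∈ A, ∀ b ∈ B ^ k, ∀ d, a ∣ d → b ∣ d →
      ∃ a' ∈ A, ∃ b' ∈ B ^ k, a * b' = b * a' ∧ IsRightLcm a b (a * b') := by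
  induction k with
  | zero =>
    intro a ha b hb d _ _
    rw [pow_zero, Set.mem_one] at hb
    subst hb
    exact ⟨a, ha, 1, by simp, by simp, by simpa using isRightLcm_one_right a⟩
  | succ k ih =>
    intro a ha b hb d had hbd
    rw [pow_succ'] at hb
    obtain ⟨b₁, hb₁, b₂, hb₂, rfl⟩ := Set.mem_mul.1 hb
    obtain ⟨a', ha', b₁', hb₁', e, hl⟩ :=
      hAB a ha b₁ hb₁ d had ((dvd_mul_right _ _).trans hbd)
    obtain ⟨f, rfl⟩ := hbd
    -- What remains after cancelling `b₁` is a common multiple of `a'` and `b₂`, so the induction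
    -- hypothesis provides the next square of the strip.
    have ha'd : a' ∣ b₂ * f := by
      apply hM.dvd_of_mul_dvd_mul (a := b₁)
      rw [← e, ← mul_assoc]
      exact hl.2.2 _ had (by rw [mul_assoc]; exact dvd_mul_right _ _)
    obtain ⟨a'', ha'', b₂', hb₂', e', hl'⟩ := ih a' ha' b₂ hb₂ _ ha'd (dvd_mul_right _ _)
    have e'' : a * (b₁' * b₂') = b₁ * b₂ * a'' := by
      rw [← mul_assoc, e, mul_assoc, e', mul_assoc]
    refine ⟨a'', ha'', b₁' * b₂', ?_, e'', ?_⟩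
    · rw [pow_succ']
      exact Set.mul_mem_mul hb₁' hb₂'
    · rw [e'']
      refine (hM.isRightLcm_mul (e ▸ hl.symm) e.symm ?_).symm
      rw [← e']
      exact hl'.symm

/-- The one-sided extension is used twice, with squares transposed in between: first `G` against `G
^ q`, then `G ^ q` against `G ^ p`. -/
theorem exists_square_pow (hM : IsConditionalLcmMonoid M) {G : Set M} (hG : IsGarsideFamily G) (p q : ℕ) :
    ∀ a ∈ G ^ p, ∀ b ∈ G ^ q, ∀ d, a ∣ d → b ∣ d →
      ∃ a' ∈ G ^ p, ∃ b' ∈ G ^ q, a * b' = b * a' ∧ IsRightLcm a b (a * b') := by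
  have flip : ∀ {A B : Set M}, (∀ a ∈ A, ∀ b ∈ B, ∀ d, a ∣ d → b ∣ d →
      ∃ a' ∈ A, ∃ b' ∈ B, a * b' = b * a' ∧ IsRightLcm a b (a * b')) →
      ∀ b ∈ B, ∀ a ∈ A, ∀ d, b ∣ d → a ∣ d →
      ∃ b' ∈ B, ∃ a' ∈ A, b * a' = a * b' ∧ IsRightLcm b a (b * a') := by
    intro A B h b hb a ha d hbd had
    obtain ⟨a', ha', b', hb', e, hl⟩ := h a ha b hb d had hbd
    exact ⟨b', hb', a', ha', e.symm, e ▸ hl.symm⟩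
  have base : ∀ a ∈ G, ∀ b ∈ G, ∀ d, a ∣ d → b ∣ d →
      ∃ a' ∈ G, ∃ b' ∈ G, a * b' = b * a' ∧ IsRightLcm a b (a * b') := by
    intro a ha b hb d had hbd
    obtain ⟨m, hm⟩ := hM.exists_lcm a b d had hbd
    obtain ⟨b', hb'⟩ := hm.1
    obtain ⟨a', ha'⟩ := hm.2.1
    exact ⟨a', hG.complement_mem b hb a ha a' (by rw [IsRightComplement, ← ha']; exact hm.symm), b',
      hG.complement_mem a ha b hb b'
        (by rw [IsRightComplement, ← hb']; exact hm), hb'.symm.trans ha', hb' ▸ hm⟩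
  exact flip (hM.exists_square_pow_right (flip (hM.exists_square_pow_right base q)) p)

/-- Split off one factor on each side and fill the `2 × 2` grid: the first diagonal `lcm(a₁, b₁)` is
in `G`, and the second is an lcm of two elements of `G ^ k`, because taking complements does not
lengthen a product. -/
theorem lcm_mem_pow (hM : IsConditionalLcmMonoid M) {G : Set M} (hG : IsGarsideFamily G) (k : ℕ) :
    ∀ a ∈ G ^ k, ∀ b ∈ G ^ k, ∀ m, IsRightLcm a b m → m ∈ G ^ k := by
  induction k with
  | zero =>
    intro a ha b hb m hm
    rw [pow_zero, Set.mem_one] at *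
    subst ha hb
    exact hM.lcm_unique hm (IsRightLcm.self 1)
  | succ k ih =>
    intro a ha b hb m hm
    rw [pow_succ'] at ha hb ⊢
    obtain ⟨a₁, ha₁, a₂, ha₂, rfl⟩ := Set.mem_mul.1 ha
    obtain ⟨b₁, hb₁, b₂, hb₂, rfl⟩ := Set.mem_mul.1 hb
    have sq := hM.exists_square_pow hG
    have ha₁m : a₁ ∣ m := (dvd_mul_right _ _).trans hm.1
    have hb₁m : b₁ ∣ m := (dvd_mul_right _ _).trans hm.2.1
    obtain ⟨a₁', ha₁', b₁', hb₁', e₁, h₁⟩ :=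
      sq 1 1 a₁ (by simpa using ha₁) b₁ (by simpa using hb₁) m ha₁m hb₁m
    have hmem : a₁ * b₁' ∈ G := hG.lcm_mem a₁ ha₁ b₁ hb₁ _ h₁
    obtain ⟨f, hf⟩ := h₁.2.2 m ha₁m hb₁m
    have ha₂f : a₂ ∣ b₁' * f := by
      apply hM.dvd_of_mul_dvd_mul (a := a₁)
      rw [← mul_assoc, ← hf]
      exact hm.1
    have hb₂f : b₂ ∣ a₁' * f := by
      apply hM.dvd_of_mul_dvd_mul (a := b₁)
      rw [← mul_assoc, ← e₁, ← hf]
      exact hm.2.1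
    obtain ⟨a₂', ha₂', x, -, e₂, h₂⟩ := sq k 1 a₂ ha₂ b₁' hb₁' _ ha₂f (dvd_mul_right _ _)
    obtain ⟨b₂', hb₂', y, -, e₃, h₃⟩ := sq k 1 b₂ hb₂ a₁' ha₁' _ hb₂f (dvd_mul_right _ _)
    have ha₂'f : a₂' ∣ f := by
      apply hM.dvd_of_mul_dvd_mul (a := b₁')
      rw [← e₂]
      exact h₂.2.2 _ ha₂f (dvd_mul_right _ _)
    have hb₂'f : b₂' ∣ f := by
      apply hM.dvd_of_mul_dvd_mul (a := a₁')
      rw [← e₃]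
      exact h₃.2.2 _ hb₂f (dvd_mul_right _ _)
    obtain ⟨n, hn⟩ := hM.exists_lcm a₂' b₂' f ha₂'f hb₂'f
    rw [hM.lcm_unique hm (hM.isRightLcm_mul_mul h₁ e₁ h₂ e₂ h₃ e₃ hn)]
    exact Set.mul_mem_mul hmem (ih a₂' ha₂' b₂' hb₂' n hn)

theorem complement_mem_pow (hM : IsConditionalLcmMonoid M) {G : Set M} (hG : IsGarsideFamily G) (k : ℕ) :
    ∀ a ∈ G ^ k, ∀ b ∈ G ^ k, ∀ c, IsRightComplement a b c → c ∈ G ^ k := by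
  intro a ha b hb c hc
  obtain ⟨_, _, b', hb', _, h⟩ := hM.exists_square_pow hG k k a ha b hb _ hc.1 hc.2.1
  rwa [hM.complement_unique hc h]

theorem closureStep_finite (hM : IsConditionalLcmMonoid M) {G : Set M} (hG : G.Finite) : (closureStep G).Finite := by
  refine (hG.union ?_).union ?_
  · have : {m | ∃ g ∈ G, ∃ h ∈ G, IsRightLcm g h m} =
        ⋃ g ∈ G, ⋃ h ∈ G, {m | IsRightLcm g h m} := by
      ext; simp
    rw [this]
    exact hG.biUnion fun g _ => hG.biUnion fun h _ =>
      Set.Subsingleton.finite fun _ h₁ _ h₂ => hM.lcm_unique h₁ h₂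
  · have : {c | ∃ g ∈ G, ∃ h ∈ G, IsRightComplement g h c} =
        ⋃ g ∈ G, ⋃ h ∈ G, {c | IsRightComplement g h c} := by
      ext; simp
    rw [this]
    exact hG.biUnion fun g _ => hG.biUnion fun h _ =>
      Set.Subsingleton.finite fun _ h₁ _ h₂ => hM.complement_unique h₁ h₂

theorem closureSeq_finite (hM : IsConditionalLcmMonoid M) {S : Set M} (hS : S.Finite) (n : ℕ) : (closureSeq S n).Finite := by
  induction n with
  | zero => exact hS
  | succ n ih => exact hM.closureStep_finite ih

/-- An irreducible product has an invertible factor, which here equals `1`, so it is equal to its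
other factor. -/
theorem mem_of_irreducible (hM : IsConditionalLcmMonoid M) {G : Set M} (hG : Submonoid.closure G = ⊤) {p : M}
    (hp : Irreducible p) : p ∈ G := by
  have key : ∀ x ∈ Submonoid.closure G, Irreducible x → x ∈ G := by
    intro x hx
    induction hx using Submonoid.closure_induction with
    | mem x h => exact fun _ => h
    | one => exact fun h => absurd isUnit_one h.not_isUnit
    | mul x y _ _ ihx ihy =>
      have unit_eq : ∀ z : M, IsUnit z → z = 1 := by
        rintro _ ⟨u, rfl⟩
        exact hM.eq_one_of_mul _ _ u.mul_inv
      intro h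
      rcases h.isUnit_or_isUnit rfl with hu | hu
      · rw [unit_eq x hu, one_mul] at h ⊢
        exact ihy h
      · rw [unit_eq y hu, mul_one] at h ⊢
        exact ihx h
  exact key p (by rw [hG]; trivial) hp

end IsConditionalLcmMonoid

/-! ### The closure process and its stabilisation -/

theorem subset_closureStep (G : Set M) : G ⊆ closureStep G :=
  fun _ h => Or.inl (Or.inl h)

theorem closureSeq_monotone (S : Set M) : Monotone (closureSeq S) :=
  monotone_nat_of_le_succ fun n => subset_closureStep (closureSeq S n)

theorem closureSeq_subset {S T : Set M} (hST : S ⊆ T)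
    (hl : ∀ g ∈ T, ∀ h ∈ T, ∀ m, IsRightLcm g h m → m ∈ T)
    (hc : ∀ g ∈ T, ∀ h ∈ T, ∀ c, IsRightComplement g h c → c ∈ T) (n : ℕ) :
    closureSeq S n ⊆ T := by
  induction n with
  | zero => exact hST
  | succ n ih =>
    rintro x ((h | ⟨g, hg, h, hh, hx⟩) | ⟨g, hg, h, hh, hx⟩)
    · exact ih h
    · exact hl g (ih hg) h (ih hh) x hx
    · exact hc g (ih hg) h (ih hh) x hx

theorem isGarsideFamily_closureSeq {S : Set M} (hS : Submonoid.closure S = ⊤) {n : ℕ}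
    (hn : closureSeq S (n + 1) = closureSeq S n) : IsGarsideFamily (closureSeq S n) where
  generates := top_le_iff.1 <| hS ▸
    Submonoid.closure_mono (closureSeq_monotone S (Nat.zero_le n))
  lcm_mem g hg h hh _ hm := hn ▸ Or.inl (Or.inr ⟨g, hg, h, hh, hm⟩)
  complement_mem g hg h hh _ hc := hn ▸ Or.inr ⟨g, hg, h, hh, hc⟩

theorem exists_closureSeq_stable {S T : Set M} (hT : T.Finite) (h : ∀ n, closureSeq S n ⊆ T) :
    ∃ n, closureSeq S (n + 1) = closureSeq S n := by
  by_contra! hne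
  -- Without stabilisation every inclusion is strict, so the cardinality outgrows that of `T`.
  have hcard : ∀ n, n ≤ (closureSeq S n).ncard := by
    intro n
    induction n with
    | zero => exact Nat.zero_le _
    | succ n ih =>
      exact Nat.succ_le_of_lt (ih.trans_lt (Set.ncard_lt_ncard
        ((closureSeq_monotone S n.le_succ).ssubset_of_ne (hne n).symm) (hT.subset (h _))))
  have := (hcard (T.ncard + 1)).trans (Set.ncard_le_ncard (h _) hT)
  omega

/-- The element is `g \ g`. Nontriviality is needed to find `g`: the empty set is a Garside family
of the trivial monoid. -/
theorem IsGarsideFamily.one_mem [Nontrivial M] {G : Set M} (hG : IsGarsideFamily G) :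
    (1 : M) ∈ G := by
  obtain ⟨g, hg⟩ : G.Nonempty := by
    by_contra! h
    have := hG.generates
    rw [h, Submonoid.closure_empty] at this
    exact bot_ne_top this
  exact hG.complement_mem g hg g hg 1 (by simpa [IsRightComplement] using IsRightLcm.self g)

theorem exists_mem_pow_of_mem_closure {G : Set M} {x : M} (hx : x ∈ Submonoid.closure G) :
    ∃ k, x ∈ G ^ k := by
  induction hx using Submonoid.closure_induction with
  | mem x h => exact ⟨1, by simpa using h⟩
  | one => exact ⟨0, by simp⟩
  | mul x y _ _ ihx ihy =>
    obtain ⟨j, hj⟩ := ihx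
    obtain ⟨k, hk⟩ := ihy
    exact ⟨j + k, pow_add G j k ▸ Set.mul_mem_mul hj hk⟩

theorem finite_pow {G : Set M} (hG : G.Finite) (k : ℕ) : (G ^ k).Finite := by
  induction k with
  | zero => simp
  | succ k ih => exact pow_succ G k ▸ ih.mul hG

/-- Some power of a finite Garside family is a finite family that is closed under right-lcm and
right-complement and contains a given finite set. -/
theorem IsConditionalLcmMonoid.exists_closureSeq_stable_of_isGarsideFamily
    (hM : IsConditionalLcmMonoid M) {S G : Set M} (hS : S.Finite) (hfin : G.Finite)
    (hG : IsGarsideFamily G) : ∃ n, closureSeq S (n + 1) = closureSeq S n := by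
  obtain ⟨k, hk⟩ : ∃ k, S ⊆ G ^ k := by
    rcases subsingleton_or_nontrivial M with hs | hn
    · exact ⟨0, fun x _ => Subsingleton.elim 1 x ▸ by simp⟩
    · have hpow : ∀ x : M, ∃ k, x ∈ G ^ k := fun x =>
        exists_mem_pow_of_mem_closure (by rw [hG.generates]; trivial)
      choose f hf using hpow
      obtain ⟨k, hk⟩ := (hS.image f).bddAbove
      -- Since `1 ∈ G`, the powers of `G` increase, so a bound on the exponents for the finite set
      -- `S` suffices.
      exact ⟨k, fun x hx =>
        Set.pow_subset_pow_right hG.one_mem (hk (Set.mem_image_of_mem f hx)) (hf x)⟩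
  exact exists_closureSeq_stable (finite_pow hfin k)
    (closureSeq_subset hk (hM.lcm_mem_pow hG k) (hM.complement_mem_pow hG k))

end Divisibility

/-! ### Right-reversing: soundness, confluence and consequences of completeness -/

section Reversing

variable {α : Type*} {rels : FreeMonoid α → FreeMonoid α → Prop}

theorem SyntacticComplement.mk_eq {s t : α} {x y : FreeMonoid α}
    (h : SyntacticComplement rels s t x y) :
    PresentedMonoid.of rels s * PresentedMonoid.mk rels x =
      PresentedMonoid.of rels t * PresentedMonoid.mk rels y := by
  rcases h with ⟨rfl, rfl, rfl⟩ | ⟨_, h | h⟩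
  · rfl
  · simpa only [map_mul, PresentedMonoid.of] using PresentedMonoid.mk_eq_mk_of_rel h
  · simpa only [map_mul, PresentedMonoid.of] using (PresentedMonoid.mk_eq_mk_of_rel h).symm

theorem SyntacticComplement.unique (hc : IsRightComplemented rels) {s t : α}
    {x y x' y' : FreeMonoid α} (h : SyntacticComplement rels s t x y)
    (h' : SyntacticComplement rels s t x' y') : x = x' ∧ y = y' := by
  rcases h with ⟨rfl, rfl, rfl⟩ | ⟨hne, h⟩
  · rcases h' with ⟨_, rfl, rfl⟩ | ⟨hne, _⟩
    · exact ⟨rfl, rfl⟩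
    · exact absurd rfl hne
  · rcases h' with ⟨rfl, _, _⟩ | ⟨_, h'⟩
    · exact absurd rfl hne
    · exact hc.unique s t hne x y x' y' h h'

variable (rels) in
/-- The signed word `w` labels a path from `a` to `b` in the Cayley graph of the presented
monoid. -/
def LabelsPath : SignedWord α → PresentedMonoid rels → PresentedMonoid rels → Prop
  | [], a, b => a = b
  | (s, true) :: w, a, b => LabelsPath w (a * PresentedMonoid.of rels s) b
  | (s, false) :: w, a, b => ∃ c, a = c * PresentedMonoid.of rels s ∧ LabelsPath w c b

theorem labelsPath_append {w₁ w₂ : SignedWord α} {a b : PresentedMonoid rels} :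
    LabelsPath rels (w₁ ++ w₂) a b ↔ ∃ c, LabelsPath rels w₁ a c ∧ LabelsPath rels w₂ c b := by
  induction w₁ generalizing a with
  | nil => simp [LabelsPath]
  | cons p w₁ ih =>
    obtain ⟨s, _ | _⟩ := p
    · simp only [List.cons_append, LabelsPath, ih]
      constructor
      · rintro ⟨d, rfl, c, h₁, h₂⟩
        exact ⟨c, ⟨d, rfl, h₁⟩, h₂⟩
      · rintro ⟨c, ⟨d, rfl, h₁⟩, h₂⟩
        exact ⟨d, rfl, c, h₁, h₂⟩
    · simp only [List.cons_append, LabelsPath, ih]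

theorem posWord_one : posWord (1 : FreeMonoid α) = [] := rfl

theorem negWord_one : negWord (1 : FreeMonoid α) = [] := rfl

theorem posWord_of_mul (s : α) (u : FreeMonoid α) :
    posWord (FreeMonoid.of s * u) = (s, true) :: posWord u := by
  simp [posWord]

theorem negWord_of_mul (s : α) (u : FreeMonoid α) :
    negWord (FreeMonoid.of s * u) = negWord u ++ [(s, false)] := by
  simp [negWord]

theorem labelsPath_posWord {u : FreeMonoid α} {a b : PresentedMonoid rels} :
    LabelsPath rels (posWord u) a b ↔ a * PresentedMonoid.mk rels u = b := by
  induction u using FreeMonoid.recOn generalizing a with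
  | one => simp [posWord_one, LabelsPath]
  | of_mul s u ih =>
    rw [posWord_of_mul, LabelsPath, ih, map_mul, ← mul_assoc]
    rfl

theorem labelsPath_negWord {u : FreeMonoid α} {a b : PresentedMonoid rels} :
    LabelsPath rels (negWord u) a b ↔ a = b * PresentedMonoid.mk rels u := by
  induction u using FreeMonoid.recOn generalizing b with
  | one => simp [negWord_one, LabelsPath]
  | of_mul s u ih =>
    rw [negWord_of_mul, labelsPath_append]
    simp only [ih, LabelsPath, map_mul, ← mul_assoc]
    constructor
    · rintro ⟨c, rfl, d, rfl, rfl⟩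
      rfl
    · rintro rfl
      exact ⟨_, rfl, b, rfl, rfl⟩

/-- A path that goes back along `s` to `e` and then forward along `t` is replaced by one through the
common multiple `e s θ(s,t) = e t θ(t,s)`, with the same endpoints. -/
theorem ReversingStep.labelsPath {w w' : SignedWord α} (h : ReversingStep rels w w')
    {a b : PresentedMonoid rels} (hw : LabelsPath rels w a b) : LabelsPath rels w' a b := by
  obtain ⟨w₁, w₂, s, t, x, y, h⟩ := h
  simp only [labelsPath_append] at hw ⊢
  obtain ⟨c, ⟨d, h₁, e, rfl, rfl⟩, h₂⟩ := hw
  refine ⟨_, ⟨_, h₁, ?_⟩, h₂⟩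
  refine ⟨_, labelsPath_posWord.2 rfl, labelsPath_negWord.2 ?_⟩
  rw [mul_assoc, mul_assoc, h.mk_eq]

/-- Right-reversing is sound: it produces common right-multiples. -/
theorem ReversesTo.mk_eq {u v u' v' : FreeMonoid α} (h : ReversesTo rels u v u' v') :
    PresentedMonoid.mk rels (u * v') = PresentedMonoid.mk rels (v * u') := by
  have key : ∀ w w' : SignedWord α, Relation.ReflTransGen (ReversingStep rels) w w' →
      ∀ a b, LabelsPath rels w a b → LabelsPath rels w' a b := by
    intro w w' hw a b h₀
    induction hw with
    | refl => exact h₀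
    | tail _ hs ih => exact hs.labelsPath ih
  -- The word `u⁻¹ v` labels the path from `u` back to `1` and on to `v`.
  have := key _ _ h (PresentedMonoid.mk rels u) (PresentedMonoid.mk rels v)
    (labelsPath_append.2 ⟨1, labelsPath_negWord.2 (one_mul _).symm,
      labelsPath_posWord.2 (one_mul _)⟩)
  obtain ⟨c, h₁, h₂⟩ := labelsPath_append.1 this
  rw [labelsPath_posWord] at h₁
  rw [labelsPath_negWord] at h₂
  rw [map_mul, map_mul, h₁, h₂]

/-- Two redexes coincide or are disjoint: in an overlap by one letter, that letter would be both
positive and negative. Coinciding redexes have equal results since `θ` is single-valued; disjoint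
ones commute. -/
theorem ReversingStep.diamond (hc : IsRightComplemented rels) {a b c : SignedWord α}
    (hab : ReversingStep rels a b) (hac : ReversingStep rels a c) :
    b = c ∨ ∃ d, ReversingStep rels b d ∧ ReversingStep rels c d := by
  obtain ⟨w₁, w₂, s, t, x, y, h⟩ := hab
  generalize ha : w₁ ++ [(s, false), (t, true)] ++ w₂ = a at hac
  obtain ⟨w₁', w₂', s', t', x', y', h'⟩ := hac
  have aux : ∀ (w₁ w₂ z w₂' : SignedWord α) (s t s' t' : α) (x y x' y' : FreeMonoid α),
      SyntacticComplement rels s t x y → SyntacticComplement rels s' t' x' y' →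
      [(s, false), (t, true)] ++ w₂ = z ++ ([(s', false), (t', true)] ++ w₂') →
      w₁ ++ (posWord x ++ negWord y) ++ w₂ = w₁ ++ z ++ (posWord x' ++ negWord y') ++ w₂' ∨
      ∃ d, ReversingStep rels (w₁ ++ (posWord x ++ negWord y) ++ w₂) d ∧
        ReversingStep rels (w₁ ++ z ++ (posWord x' ++ negWord y') ++ w₂') d := by
    intro w₁ w₂ z w₂' s t s' t' x y x' y' h h' e
    match z, e with
    | [], e =>
      simp only [List.cons_append, List.nil_append, List.cons.injEq, Prod.mk.injEq,
        and_true] at e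
      obtain ⟨rfl, rfl, rfl⟩ := e
      obtain ⟨rfl, rfl⟩ := h.unique hc h'
      left
      simp
    | [p], e => simp at e
    | p :: q :: r, e =>
      simp only [List.cons_append, List.nil_append, List.cons.injEq] at e
      obtain ⟨rfl, rfl, rfl⟩ := e
      right
      refine ⟨w₁ ++ (posWord x ++ negWord y) ++ r ++ (posWord x' ++ negWord y') ++ w₂', ?_, ?_⟩
      · simpa only [List.append_assoc, List.cons_append, List.nil_append] using
          ReversingStep.step (w₁ ++ (posWord x ++ negWord y) ++ r) w₂' s' t' x' y' h'
      · simpa only [List.append_assoc, List.cons_append, List.nil_append] using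
          ReversingStep.step w₁ (r ++ (posWord x' ++ negWord y') ++ w₂') s t x y h
  rw [List.append_assoc, List.append_assoc, List.append_eq_append_iff] at ha
  rcases ha with ⟨z, rfl, e⟩ | ⟨z, rfl, e⟩
  · exact aux w₁ w₂ z w₂' s t s' t' x y x' y' h h' e
  · rcases aux w₁' w₂' z w₂ s' t' s t x' y' x y h' h e with e | ⟨d, h₁, h₂⟩
    · exact Or.inl e.symm
    · exact Or.inr ⟨d, h₂, h₁⟩

theorem not_reversingStep_posWord_append_negWord (u v : FreeMonoid α) (w : SignedWord α) :
    ¬ ReversingStep rels (posWord v ++ negWord u) w := by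
  -- No negative letter precedes a positive one, whereas a redex is such a pair.
  have hp : (posWord v ++ negWord u).Pairwise fun p q => q.2 = true → p.2 = true := by
    refine List.pairwise_append.2 ⟨?_, ?_, ?_⟩
    · exact List.pairwise_map.2 (List.pairwise_of_forall fun _ _ _ => rfl)
    · exact List.pairwise_map.2 (List.pairwise_of_forall fun _ _ h => h)
    · intro p hp q _ _
      obtain ⟨s, _, rfl⟩ := List.mem_map.1 hp
      rfl
  intro h
  generalize posWord v ++ negWord u = z at h hp
  obtain ⟨w₁, w₂, s, t, x, y, -⟩ := h
  simp [List.pairwise_append] at hp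

theorem posWord_append_negWord_inj {u v u' v' : FreeMonoid α}
    (h : posWord v ++ negWord u = posWord v' ++ negWord u') : u = u' ∧ v = v' := by
  have h₁ := congrArg (fun w => (w.filter fun p => p.2).map Prod.fst) h
  have h₂ := congrArg (fun w => (w.filter fun p => !p.2).map Prod.fst) h
  simp [posWord, negWord, List.filter_map, Function.comp_def] at h₁ h₂
  exact ⟨h₂, h₁⟩

theorem ReversesTo.unique (hc : IsRightComplemented rels) {u v u₁ v₁ u₂ v₂ : FreeMonoid α}
    (h₁ : ReversesTo rels u v u₁ v₁) (h₂ : ReversesTo rels u v u₂ v₂) : u₁ = u₂ ∧ v₁ = v₂ := by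
  obtain ⟨w, hw₁, hw₂⟩ := Relation.church_rosser (r := ReversingStep rels) (fun a b c hab hac => by
    rcases hab.diamond hc hac with rfl | ⟨d, hb, hc⟩
    · exact ⟨b, .refl, .refl⟩
    · exact ⟨d, .single hb, .single hc⟩) h₁ h₂
  have normal : ∀ (u v : FreeMonoid α) (w : SignedWord α),
      Relation.ReflTransGen (ReversingStep rels) (posWord v ++ negWord u) w →
      w = posWord v ++ negWord u := by
    intro u v w h
    rcases Relation.ReflTransGen.cases_head h with h | ⟨z, hz, _⟩
    · exact h.symm
    · exact absurd hz (not_reversingStep_posWord_append_negWord u v z)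
  exact posWord_append_negWord_inj ((normal _ _ _ hw₁).symm.trans (normal _ _ _ hw₂))

theorem reversesTo_of_self (s : α) :
    ReversesTo rels (FreeMonoid.of s) (FreeMonoid.of s) 1 1 := by
  refine Relation.ReflTransGen.single ?_
  simpa [posWord, negWord] using
    ReversingStep.step (rels := rels) [] [] s s 1 1 (Or.inl ⟨rfl, rfl, rfl⟩)

/-- It suffices to cancel one letter. Since `s⁻¹ s` reverses only to the empty word, completeness
applied to `s x = s y` makes both `x` and `y` equal to the same `w'`. -/
theorem ReversingComplete.mul_left_cancel (hc : IsRightComplemented rels)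
    (hr : ReversingComplete rels) (a b c : PresentedMonoid rels) (h : a * b = a * c) : b = c := by
  obtain ⟨u, rfl⟩ := PresentedMonoid.surjective_mk a
  induction u using FreeMonoid.recOn with
  | one => simpa using h
  | of_mul s u ih =>
    apply ih
    obtain ⟨x, rfl⟩ := PresentedMonoid.surjective_mk b
    obtain ⟨y, rfl⟩ := PresentedMonoid.surjective_mk c
    simp only [← map_mul, mul_assoc] at h ⊢
    obtain ⟨u', v', w', hs, h₁, h₂⟩ := hr _ _ _ _ h
    obtain ⟨rfl, rfl⟩ := hs.unique hc (reversesTo_of_self s)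
    exact h₂.symm.trans h₁

theorem IsRightComplemented.eq_one_of_mul (hc : IsRightComplemented rels)
    (a b : PresentedMonoid rels) (h : a * b = 1) : a = 1 := by
  have lift_zero : ∀ u : FreeMonoid α, u ≠ 1 → FreeMonoid.lift (fun _ => (0 : ℕ)) u = 0 := by
    intro u
    cases u using FreeMonoid.casesOn with
    | one => exact fun h => absurd rfl h
    | of_mul s u => simp
  -- This morphism to multiplicative `ℕ` detects the empty word: it is `1` there and `0` on nonempty
  -- words. It respects the relations because none equates a nonempty word with `ε`.
  let f : PresentedMonoid rels →* ℕ := PresentedMonoid.lift (fun _ => 0) (by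
    intro u v huv
    by_cases hu : u = 1
    · rw [hu, hc.no_eps v (Or.inr (hu ▸ huv))]
    · by_cases hv : v = 1
      · exact absurd (hc.no_eps u (Or.inl (hv ▸ huv))) hu
      · rw [lift_zero u hu, lift_zero v hv])
  obtain ⟨u, rfl⟩ := PresentedMonoid.surjective_mk a
  by_contra hne
  have hu : f (PresentedMonoid.mk rels u) = 0 :=
    lift_zero u fun hu => hne (by rw [hu, map_one])
  have := congrArg f h
  rw [map_mul, hu, zero_mul, map_one] at this
  exact zero_ne_one this

theorem ReversesTo.isRightLcm (hc : IsRightComplemented rels) (hr : ReversingComplete rels)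
    {u v u' v' : FreeMonoid α} (h : ReversesTo rels u v u' v') :
    IsRightLcm (PresentedMonoid.mk rels u) (PresentedMonoid.mk rels v)
      (PresentedMonoid.mk rels (u * v')) := by
  refine ⟨map_mul (PresentedMonoid.mk rels) u v' ▸ dvd_mul_right _ _,
    h.mk_eq ▸ map_mul (PresentedMonoid.mk rels) v u' ▸ dvd_mul_right _ _, ?_⟩
  rintro d ⟨x, rfl⟩ ⟨y, e⟩
  obtain ⟨x, rfl⟩ := PresentedMonoid.surjective_mk x
  obtain ⟨y, rfl⟩ := PresentedMonoid.surjective_mk y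
  simp only [← map_mul] at e
  obtain ⟨u₁, v₁, w, h₁, _, hx⟩ := hr u v y x e
  -- The reversing supplied by completeness for this multiple is the given one, so the multiple
  -- factors through `u v'`.
  obtain ⟨rfl, rfl⟩ := h.unique hc h₁
  exact ⟨PresentedMonoid.mk rels w, by rw [← hx, ← map_mul, ← map_mul, mul_assoc]⟩

theorem ReversingComplete.exists_reversesTo (hr : ReversingComplete rels) {u v : FreeMonoid α}
    {d : PresentedMonoid rels} (hu : PresentedMonoid.mk rels u ∣ d)
    (hv : PresentedMonoid.mk rels v ∣ d) : ∃ u' v', ReversesTo rels u v u' v' := by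
  obtain ⟨x, rfl⟩ := hu
  obtain ⟨y, e⟩ := hv
  obtain ⟨x, rfl⟩ := PresentedMonoid.surjective_mk x
  obtain ⟨y, rfl⟩ := PresentedMonoid.surjective_mk y
  simp only [← map_mul] at e
  obtain ⟨u', v', _, h, _⟩ := hr u v y x e
  exact ⟨u', v', h⟩

theorem ReversingComplete.isConditionalLcmMonoid (hc : IsRightComplemented rels)
    (hr : ReversingComplete rels) : IsConditionalLcmMonoid (PresentedMonoid rels) where
  cancel := hr.mul_left_cancel hc
  eq_one_of_mul := hc.eq_one_of_mul
  exists_lcm a b d ha hb := by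
    obtain ⟨u, rfl⟩ := PresentedMonoid.surjective_mk a
    obtain ⟨v, rfl⟩ := PresentedMonoid.surjective_mk b
    obtain ⟨u', v', h⟩ := hr.exists_reversesTo ha hb
    exact ⟨_, h.isRightLcm hc hr⟩

theorem isRightLcm_mk_iff (hc : IsRightComplemented rels) (hr : ReversingComplete rels)
    (u v : FreeMonoid α) (m : PresentedMonoid rels) :
    IsRightLcm (PresentedMonoid.mk rels u) (PresentedMonoid.mk rels v) m ↔
      ∃ u' v' : FreeMonoid α, ReversesTo rels u v u' v' ∧
        m = PresentedMonoid.mk rels (u * v') := by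
  constructor
  · intro hm
    obtain ⟨u', v', h⟩ := hr.exists_reversesTo hm.1 hm.2.1
    exact ⟨u', v', h, (hr.isConditionalLcmMonoid hc).lcm_unique hm (h.isRightLcm hc hr)⟩
  · rintro ⟨u', v', h, rfl⟩
    exact h.isRightLcm hc hr

theorem isRightComplement_mk_iff (hc : IsRightComplemented rels) (hr : ReversingComplete rels)
    (u v : FreeMonoid α) (c : PresentedMonoid rels) :
    IsRightComplement (PresentedMonoid.mk rels u) (PresentedMonoid.mk rels v) c ↔
      ∃ u' v' : FreeMonoid α, ReversesTo rels u v u' v' ∧ c = PresentedMonoid.mk rels v' := by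
  rw [IsRightComplement, isRightLcm_mk_iff hc hr]
  refine exists_congr fun u' => exists_congr fun v' => and_congr_right fun _ => ?_
  rw [map_mul]
  exact ⟨hr.mul_left_cancel hc _ _ _, fun h => h ▸ rfl⟩

end Reversing

end RightReversing

theorem mainTheorem3 {α : Type*} [Finite α] (rels : FreeMonoid α → FreeMonoid α → Prop)
    (hcompl : RightReversing.IsRightComplemented rels)
    (hrev : RightReversing.ReversingComplete rels)
    (hnoeth : RightReversing.IsNoetherianMonoid (PresentedMonoid rels)) :
    -- the right-lcms and right-complements used in the process are those that right-reversing finds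
    (∀ u v : FreeMonoid α,
      (∀ m : PresentedMonoid rels,
        RightReversing.IsRightLcm (PresentedMonoid.mk rels u) (PresentedMonoid.mk rels v) m ↔
          ∃ u' v' : FreeMonoid α, RightReversing.ReversesTo rels u v u' v' ∧
            m = PresentedMonoid.mk rels (u * v')) ∧
      (∀ c : PresentedMonoid rels,
        RightReversing.IsRightComplement (PresentedMonoid.mk rels u) (PresentedMonoid.mk rels v) c ↔
          ∃ u' v' : FreeMonoid α, RightReversing.ReversesTo rels u v u' v' ∧
            c = PresentedMonoid.mk rels v')) ∧
    -- the process ends if and only if there is a finite Garside family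
    ((∃ n : ℕ, RightReversing.garsideSeq rels (n + 1) = RightReversing.garsideSeq rels n) ↔
      ∃ G : Set (PresentedMonoid rels), G.Finite ∧ RightReversing.IsGarsideFamily G) ∧
    -- and then the stable set is the smallest Garside family
    (∀ n : ℕ, RightReversing.garsideSeq rels (n + 1) = RightReversing.garsideSeq rels n →
      (RightReversing.garsideSeq rels n).Finite ∧
      IsLeast {G : Set (PresentedMonoid rels) | RightReversing.IsGarsideFamily G ∧
        Set.range (PresentedMonoid.of rels) ⊆ G} (RightReversing.garsideSeq rels n) ∧
      ((∀ s : α, Irreducible (PresentedMonoid.of rels s)) →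
        IsLeast {G : Set (PresentedMonoid rels) | RightReversing.IsGarsideFamily G}
          (RightReversing.garsideSeq rels n))) := by
  have hM := hrev.isConditionalLcmMonoid hcompl
  have hS : (Set.range (PresentedMonoid.of rels)).Finite := Set.finite_range _
  have garside := fun n => RightReversing.isGarsideFamily_closureSeq (n := n)
    (PresentedMonoid.closure_range_of rels)
  have least : ∀ n, ∀ G : Set (PresentedMonoid rels), RightReversing.IsGarsideFamily G →
      Set.range (PresentedMonoid.of rels) ⊆ G → RightReversing.garsideSeq rels n ⊆ G :=
    fun n _ hG h => RightReversing.closureSeq_subset h hG.lcm_mem hG.complement_mem n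
  refine ⟨fun u v => ⟨RightReversing.isRightLcm_mk_iff hcompl hrev u v,
    RightReversing.isRightComplement_mk_iff hcompl hrev u v⟩, ⟨?_, ?_⟩, fun n hn => ⟨?_, ?_, ?_⟩⟩
  · rintro ⟨n, hn⟩
    exact ⟨_, hM.closureSeq_finite hS n, garside n hn⟩
  · rintro ⟨G, hfin, hG⟩
    exact hM.exists_closureSeq_stable_of_isGarsideFamily hS hfin hG
  · exact hM.closureSeq_finite hS n
  · exact ⟨⟨garside n hn, RightReversing.closureSeq_monotone _ (Nat.zero_le n)⟩,
      fun G hG => least n G hG.1 hG.2⟩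
  · refine fun hirr => ⟨garside n hn, fun G hG => least n G hG ?_⟩
    rintro _ ⟨s, rfl⟩
    exact hM.mem_of_irreducible hG.generates (hirr s)
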